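/- Let $(A,B)$ be a random vector in $\mathbb R^2$ with $A>0$ a.s., let $(A_n,B_n)_{n\ge 1}$ be i.i.d. copies of $(A,B)$, let $X_0$ be a real random variable independent of $(A_n,B_n)_{n\ge1}$, and let $X_n=A_nX_{n-1}+B_n$ for $n\ge 1$. Suppose that for some $\alpha>0$: (i) $\mathbb E[A^\alpha]<\infty$ and, for every $y>0$, $\mathbb P[A>ty]\sim y^{-\alpha}\,\mathbb P[A>t]$ as $t\to\infty$; (ii) $\mathbb P[AA'>t]\sim 2\,\mathbb E[A^\alpha]\,\mathbb P[A>t]$ as $t\to\infty$, where $A'$ is an independent copy of $A$; (iii) $\mathbb E[A^\alpha]<1$; (iv) $\limsup_{t\to\infty}\mathbb P[|B|>t]/\mathbb P[A>t]<\infty$. Here $g(t)\sim h(t)$ means $g(t)/h(t)\to1$ as $t\to\infty$. Then the series $$X=\sum_{k=0}^\infty B_{k+1}\prod_{j=1}^kA_j$$ converges absolutely a.s.; its law is the unique probability law satisfying $X\stackrel{d}{=}AX+B$ with $X$ independent of $(A,B)$; the Markov chain $(X_n)_{n\ge0}$ converges weakly to $X$; and $$\mathbb P[|X|>t]=O(\mathbb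 P[A>t])\qquad\text{as }t\to\infty .$$ If, furthermore, $\mathbb P[A>t,\,B<-t]=o(\mathbb P[A>t])$ as $t\to\infty$ and there is no $c\in\mathbb R$ with $Ac+B=c$ a.s. (equivalently, $X$ is not a.s. constant), then $\mathbb P[|X|>t]\asymp\mathbb P[A>t]$, that is, $$0<\liminf_{t\to\infty}\frac{\mathbb P[|X|>t]}{\mathbb P[A>t]}\le\limsup_{t\to\infty}\frac{\mathbb P[|X|>t]}{\mathbb P[A>t]}<\infty .$$ -/

import Mathlib

open MeasureTheory ProbabilityTheory Filter Topology Asymptotics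
open scoped ENNReal

noncomputable section

/-- `g(t) ∼ h(t)` as `t → ∞`, i.e. `g(t) / h(t) → 1` (this forces `h(t) ≠ 0` for large `t`). -/
def AsympEq (g h : ℝ → ℝ) : Prop :=
  Tendsto (fun t => g t / h t) atTop (𝓝 1)

/-- `g(t) ≍ h(t)` as `t → ∞`, i.e. `0 < liminf g(t) / h(t) ≤ limsup g(t) / h(t) < ∞`,
with the limits inferior and superior computed in `[0, ∞]`. -/
def WeaklyEquiv (g h : ℝ → ℝ≥0∞) : Prop :=
  0 < liminf (fun t => g t / h t) atTop ∧ limsup (fun t => g t / h t) atTop < ∞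

variable {Ω : Type*}

/-- The affine recursion `X_{n+1} = A_{n+1} X_n + B_{n+1}` started at `X₀`.
The coefficient pairs are indexed from `0`, so `(A n, B n)` stands for `(A_{n+1}, B_{n+1})`. -/
def affineChain (A B : ℕ → Ω → ℝ) (X₀ : Ω → ℝ) : ℕ → Ω → ℝ
  | 0 => X₀
  | n + 1 => fun ω => A n ω * affineChain A B X₀ n ω + B n ω

/-- The terms `B_{k+1} A_1 ⋯ A_k` of the perpetuity series. -/
def perpetuityTerm (A B : ℕ → Ω → ℝ) (k : ℕ) (ω : Ω) : ℝ :=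
  B k ω * ∏ j ∈ Finset.range k, A j ω

/-- The perpetuity `X = ∑_{k ≥ 0} B_{k+1} A_1 ⋯ A_k`. -/
def perpetuity (A B : ℕ → Ω → ℝ) (ω : Ω) : ℝ :=
  ∑' k, perpetuityTerm A B k ω

/-- `ν` is the law of a random variable `X` with `X = A X + B` in distribution, where `X` is
independent of `(A, B)` and `(A, B)` has law `κ`. -/
def IsStationaryLaw (κ : Measure (ℝ × ℝ)) (ν : Measure ℝ) : Prop :=
  (κ.prod ν).map (fun p : (ℝ × ℝ) × ℝ => p.1.1 * p.2 + p.1.2) = ν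

end

/-! Write `G(t) = P(A > t)`, `m = E[A^α] < 1`, `Π_n = A_1 ⋯ A_n`, and `S_n` for the partial sums of
the series.

Convergence: with `δ = min α 1`, Bernoulli's inequality gives `E[A^δ] < 1`, and (iv) gives `E|B|^δ <
∞`. The expected `δ`-th powers of the terms form a geometric series, so the series converges
absolutely and `Π_n → 0` a.s. Peeling off the first pair from `S_n`, or the last pair from the chain
started at `0`, shows that both have law `T^n δ_0`, where `T` is `affineLaw`. Stationarity and weak
convergence follow from the a.s. limit of `S_n`; uniqueness follows because `S_n + Π_n x` keeps a
stationary law.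

Upper bound: for a suitable `t₀`, the class of `Y` with `P(|Y| > s) ≤ P(A > s | A > t₀)` for all `s`
is preserved by `Y ↦ AY + B` (`exists_threshold`, `affineLaw_tail_le`). Indeed `P(|AY + B| > t)` is
at most `P(AA' > (1 - d)t | A' > t₀) + P(|B| > dt)`. By (ii) and dominated convergence, `P(AA' > t,
A' > K) / G(t)` tends to `2m - E[A^α; A ≤ K]`, which is close to `m < 1` for large `K`. The
remaining gap absorbs the term in `B`, which carries a factor `G(t₀)` once the conditioning is
cleared. The class contains `0`, and its bound survives weak limits, so it reaches `X`.

Lower bound: one large `A`, together with an independent event for `X` of positive probability,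
forces `|AX + B| > t`. -/

/-- Almost everywhere limits of two sequences of random variables with the same laws have the
same law. -/
theorem map_eq_of_tendsto_ae {Ω Ω' : Type*} [MeasurableSpace Ω] [MeasurableSpace Ω']
    {P : Measure Ω} {P' : Measure Ω'} [IsProbabilityMeasure P] [IsProbabilityMeasure P']
    {Z : ℕ → Ω → ℝ} {Z' : ℕ → Ω' → ℝ} {Y : Ω → ℝ} {Y' : Ω' → ℝ}
    (hZ : ∀ n, Measurable (Z n)) (hZ' : ∀ n, Measurable (Z' n))
    (h : ∀ᵐ ω ∂P, Tendsto (fun n => Z n ω) atTop (𝓝 (Y ω)))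
    (h' : ∀ᵐ ω ∂P', Tendsto (fun n => Z' n ω) atTop (𝓝 (Y' ω)))
    (hlaw : ∀ n, P.map (Z n) = P'.map (Z' n)) : P.map Y = P'.map Y' := by
  have hd := (tendstoInMeasure_of_tendsto_ae (fun n => (hZ n).aestronglyMeasurable) h).tendstoInDistribution
    (fun n => (hZ n).aemeasurable)
  have hd' := (tendstoInMeasure_of_tendsto_ae (fun n => (hZ' n).aestronglyMeasurable)
    h').tendstoInDistribution (fun n => (hZ' n).aemeasurable)
  have h1 := hd.tendsto
  have h2 := hd'.tendsto
  simp only [hlaw] at h1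
  exact congrArg (fun ρ : ProbabilityMeasure ℝ => (ρ : Measure ℝ)) (tendsto_nhds_unique h1 h2)

/-- Functions of disjoint blocks of an independent family are independent. -/
theorem ProbabilityTheory.iIndepFun.indepFun_of_measurable_iSup {Ω ι E F F' : Type*}
    [MeasurableSpace Ω] {P : Measure Ω} [mE : MeasurableSpace E] [MeasurableSpace F]
    [MeasurableSpace F'] {u : ι → Ω → E} (hu : ∀ i, Measurable (u i)) (hindep : iIndepFun u P)
    {S T : Set ι} (hST : Disjoint S T) {f : Ω → F} {g : Ω → F'}
    (hf : Measurable[⨆ i ∈ S, MeasurableSpace.comap (u i) mE] f)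
    (hg : Measurable[⨆ i ∈ T, MeasurableSpace.comap (u i) mE] g) : IndepFun f g P := by
  have := indep_iSup_of_disjoint (fun i => (hu i).comap_le) hindep hST
  exact indep_of_indep_of_le_left (indep_of_indep_of_le_right this hg.comap_le) hf.comap_le

/-! ### Partial sums and their measurability -/

/-- The law of `A X + B` when `(A, B)` has law `κ` and `X` has law `ν` independently. -/
noncomputable def affineLaw (κ : Measure (ℝ × ℝ)) (ν : Measure ℝ) : Measure ℝ :=
  (κ.prod ν).map (fun p : (ℝ × ℝ) × ℝ => p.1.1 * p.2 + p.1.2)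

/-- The partial sums of the perpetuity. -/
noncomputable def perpetuitySum {Ω : Type*} (A B : ℕ → Ω → ℝ) (n : ℕ) (ω : Ω) : ℝ :=
  ∑ k ∈ Finset.range n, perpetuityTerm A B k ω

theorem perpetuitySum_succ' {Ω : Type*} (A B : ℕ → Ω → ℝ) (n : ℕ) (ω : Ω) :
    perpetuitySum A B (n + 1) ω =
      A 0 ω * perpetuitySum (fun k => A (k + 1)) (fun k => B (k + 1)) n ω + B 0 ω := by
  simp only [perpetuitySum, perpetuityTerm, Finset.sum_range_succ', Finset.mul_sum,
    Finset.prod_range_succ', Finset.prod_range_zero, mul_one, add_left_inj]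
  exact Finset.sum_congr rfl fun k _ => by ring

theorem perpetuitySum_succ {Ω : Type*} (A B : ℕ → Ω → ℝ) (n : ℕ) (ω : Ω) :
    perpetuitySum A B (n + 1) ω =
      perpetuitySum A B n ω + B n ω * ∏ j ∈ Finset.range n, A j ω :=
  Finset.sum_range_succ _ _

section Measurability

variable {Ω : Type*} {m : MeasurableSpace Ω} {A B : ℕ → Ω → ℝ}

theorem measurable_prod_range {n : ℕ} (hA : ∀ i < n, Measurable (A i)) :
    Measurable (fun ω => ∏ j ∈ Finset.range n, A j ω) :=
  Finset.measurable_fun_prod _ fun j hj => hA j (Finset.mem_range.1 hj)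

theorem measurable_perpetuitySum {n : ℕ} (hA : ∀ i < n, Measurable (A i))
    (hB : ∀ i < n, Measurable (B i)) : Measurable (perpetuitySum A B n) := by
  refine Finset.measurable_fun_sum _ fun k hk => ?_
  have hk := Finset.mem_range.1 hk
  exact (hB k hk).mul (measurable_prod_range fun i hi => hA i (hi.trans hk))

theorem measurable_affineChain {X₀ : Ω → ℝ} (hX₀ : Measurable X₀) {n : ℕ}
    (hA : ∀ i < n, Measurable (A i)) (hB : ∀ i < n, Measurable (B i)) :
    Measurable (affineChain A B X₀ n) := by
  induction n with
  | zero => exact hX₀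
  | succ n ih =>
    exact ((hA n n.lt_succ_self).mul (ih (fun i hi => hA i (hi.trans n.lt_succ_self))
      (fun i hi => hB i (hi.trans n.lt_succ_self)))).add (hB n n.lt_succ_self)

/-- The `σ`-algebra generated by the pairs `(A i, B i)`, `i ∈ S`. -/
abbrev pairAlgebra (A B : ℕ → Ω → ℝ) (S : Set ℕ) : MeasurableSpace Ω :=
  ⨆ i ∈ S, MeasurableSpace.comap (fun ω => (A i ω, B i ω)) inferInstance

theorem measurable_pair_pairAlgebra (A B : ℕ → Ω → ℝ) {S : Set ℕ} {i : ℕ} (hi : i ∈ S) :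
    Measurable[pairAlgebra A B S] (fun ω => (A i ω, B i ω)) :=
  (comap_measurable _).mono (le_iSup₂_of_le i hi le_rfl) le_rfl

theorem measurable_fst_pairAlgebra (A B : ℕ → Ω → ℝ) {S : Set ℕ} {i : ℕ} (hi : i ∈ S) :
    Measurable[pairAlgebra A B S] (A i) :=
  measurable_fst.comp (measurable_pair_pairAlgebra A B hi)

theorem measurable_snd_pairAlgebra (A B : ℕ → Ω → ℝ) {S : Set ℕ} {i : ℕ} (hi : i ∈ S) :
    Measurable[pairAlgebra A B S] (B i) :=
  measurable_snd.comp (measurable_pair_pairAlgebra A B hi)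

end Measurability

/-! ### I.i.d. pairs and iterates of the affine map on laws -/

/-- The sequence of pairs `(A n, B n)` is independent with common law `κ`. -/
structure IsIIDPairs {Ω : Type*} [MeasurableSpace Ω] (P : Measure Ω) (κ : Measure (ℝ × ℝ))
    (A B : ℕ → Ω → ℝ) : Prop where
  measurable_A : ∀ n, Measurable (A n)
  measurable_B : ∀ n, Measurable (B n)
  indep : iIndepFun (fun n ω => (A n ω, B n ω)) P
  law : ∀ n, P.map (fun ω => (A n ω, B n ω)) = κ

namespace IsIIDPairs

variable {Ω : Type*} [MeasurableSpace Ω] {P : Measure Ω} {κ : Measure (ℝ × ℝ)} {A B : ℕ → Ω → ℝ}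

theorem measurable_pair (h : IsIIDPairs P κ A B) (n : ℕ) :
    Measurable (fun ω => (A n ω, B n ω)) :=
  (h.measurable_A n).prodMk (h.measurable_B n)

theorem isProbabilityMeasure [IsProbabilityMeasure P] (h : IsIIDPairs P κ A B) : IsProbabilityMeasure κ :=
  h.law 0 ▸ Measure.isProbabilityMeasure_map (h.measurable_pair 0).aemeasurable

theorem shift (h : IsIIDPairs P κ A B) :
    IsIIDPairs P κ (fun n => A (n + 1)) (fun n => B (n + 1)) where
  measurable_A _ := h.measurable_A _
  measurable_B _ := h.measurable_B _
  indep := h.indep.precomp (add_left_injective 1)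
  law _ := h.law _

theorem indepFun [IsProbabilityMeasure P] {F F' : Type*} [MeasurableSpace F] [MeasurableSpace F']
    (h : IsIIDPairs P κ A B) {S T : Set ℕ} (hST : Disjoint S T) {f : Ω → F} {g : Ω → F'}
    (hf : Measurable[pairAlgebra A B S] f) (hg : Measurable[pairAlgebra A B T] g) :
    IndepFun f g P :=
  iIndepFun.indepFun_of_measurable_iSup h.measurable_pair h.indep hST hf hg

theorem map_affine [IsProbabilityMeasure P] (h : IsIIDPairs P κ A B) {n : ℕ} {Y : Ω → ℝ} (hY : Measurable Y)
    (hind : IndepFun (fun ω => (A n ω, B n ω)) Y P) :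
    P.map (fun ω => A n ω * Y ω + B n ω) = affineLaw κ (P.map Y) := by
  rw [affineLaw, ← h.law n, ← (indepFun_iff_map_prod_eq_prod_map_map
    (h.measurable_pair n).aemeasurable hY.aemeasurable).1 hind,
    Measure.map_map (by fun_prop) ((h.measurable_pair n).prodMk hY)]
  rfl

/-- The recursion peels off the first pair; the remaining sum is built from the shifted sequence,
which is independent of that pair and again i.i.d. with law `κ`. -/
theorem map_perpetuitySum [IsProbabilityMeasure P] (h : IsIIDPairs P κ A B) (n : ℕ) :
    P.map (perpetuitySum A B n) = (affineLaw κ)^[n] (Measure.dirac 0) := by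
  induction n generalizing A B with
  | zero =>
    have : perpetuitySum A B 0 = fun _ => 0 := by ext; simp [perpetuitySum]
    simp [this, Measure.map_const]
  | succ n ih =>
    rw [Function.iterate_succ_apply', ← ih h.shift, ← h.map_affine (n := 0)]
    · exact congrArg (Measure.map · P) (funext fun ω => perpetuitySum_succ' A B n ω)
    · exact measurable_perpetuitySum (fun _ _ => h.measurable_A _)
        (fun _ _ => h.measurable_B _)
    · refine h.indepFun (S := {0}) (T := {0}ᶜ) disjoint_compl_right
        (measurable_pair_pairAlgebra A B rfl) ?_
      exact measurable_perpetuitySum (m := pairAlgebra A B {0}ᶜ)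
        (fun _ _ => measurable_fst_pairAlgebra A B (by simp))
        (fun _ _ => measurable_snd_pairAlgebra A B (by simp))

theorem map_perpetuitySum_succ [IsProbabilityMeasure P] (h : IsIIDPairs P κ A B) (n : ℕ) :
    P.map (perpetuitySum A B (n + 1)) = affineLaw κ (P.map (perpetuitySum A B n)) := by
  rw [h.map_perpetuitySum, h.map_perpetuitySum, Function.iterate_succ_apply']

/-- The chain peels off the last pair instead, yet yields the same iterates. Thus its laws are those
of the partial sums, which, unlike the chain, have an almost sure limit. -/
theorem map_affineChain_zero [IsProbabilityMeasure P] (h : IsIIDPairs P κ A B) (n : ℕ) :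
    P.map (affineChain A B (fun _ => 0) n) = (affineLaw κ)^[n] (Measure.dirac 0) := by
  induction n with
  | zero => simp [affineChain, Measure.map_const]
  | succ n ih =>
    rw [Function.iterate_succ_apply', ← ih, ← h.map_affine (n := n)]
    · rfl
    · exact measurable_affineChain measurable_const (fun _ _ => h.measurable_A _)
        (fun _ _ => h.measurable_B _)
    · refine h.indepFun (S := {n}) (T := Set.Iio n) (by simp)
        (measurable_pair_pairAlgebra A B rfl) ?_
      exact measurable_affineChain (m := pairAlgebra A B (Set.Iio n)) measurable_const
        (fun i hi => measurable_fst_pairAlgebra A B hi)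
        (fun i hi => measurable_snd_pairAlgebra A B hi)

theorem measurable_perpetuitySum (h : IsIIDPairs P κ A B) (n : ℕ) :
    Measurable (perpetuitySum A B n) :=
  _root_.measurable_perpetuitySum (fun _ _ => h.measurable_A _) (fun _ _ => h.measurable_B _)

theorem measurable_prod_range (h : IsIIDPairs P κ A B) (n : ℕ) :
    Measurable (fun ω => ∏ j ∈ Finset.range n, A j ω) :=
  _root_.measurable_prod_range (fun _ _ => h.measurable_A _)

theorem indepFun_past_pair [IsProbabilityMeasure P] (h : IsIIDPairs P κ A B) (n : ℕ) :
    IndepFun (fun ω => (perpetuitySum A B n ω, ∏ j ∈ Finset.range n, A j ω))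
      (fun ω => (A n ω, B n ω)) P := by
  refine h.indepFun (S := Set.Iio n) (T := {n}) (by simp) ?_ (measurable_pair_pairAlgebra A B rfl)
  exact Measurable.prodMk (m := pairAlgebra A B (Set.Iio n))
    (_root_.measurable_perpetuitySum (m := pairAlgebra A B (Set.Iio n))
      (fun i hi => measurable_fst_pairAlgebra A B hi)
      (fun i hi => measurable_snd_pairAlgebra A B hi))
    (_root_.measurable_prod_range (m := pairAlgebra A B (Set.Iio n))
      (fun i hi => measurable_fst_pairAlgebra A B hi))

/-- A stationary law is the law of `S_n + Π_n x` for every `n`. -/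
theorem map_perpetuitySum_add_of_isStationaryLaw [IsProbabilityMeasure P] (h : IsIIDPairs P κ A B) {ν : Measure ℝ}
    [IsProbabilityMeasure ν] (hν : IsStationaryLaw κ ν) (n : ℕ) :
    (P.prod ν).map (fun q : Ω × ℝ =>
      perpetuitySum A B n q.1 + (∏ j ∈ Finset.range n, A j q.1) * q.2) = ν := by
  have := h.isProbabilityMeasure
  induction n with
  | zero => simp [perpetuitySum]
  | succ n ih =>
    set Z : Ω → ℝ × ℝ := fun ω => (perpetuitySum A B n ω, ∏ j ∈ Finset.range n, A j ω) with hZ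
    have hZm : Measurable Z := (h.measurable_perpetuitySum n).prodMk (h.measurable_prod_range n)
    have : IsProbabilityMeasure (P.map Z) := Measure.isProbabilityMeasure_map hZm.aemeasurable
    have hjoint := (indepFun_iff_map_prod_eq_prod_map_map hZm.aemeasurable
      (h.measurable_pair n).aemeasurable).1 (h.indepFun_past_pair n)
    rw [h.law] at hjoint
    have e1 : (P.prod ν).map (fun q : Ω × ℝ => (Z q.1, q.2)) = (P.map Z).prod ν := by
      have := Measure.map_prod_map P ν hZm measurable_id
      rw [Measure.map_id] at this
      exact this.symm
    have e2 : (P.prod ν).map (fun q : Ω × ℝ => ((Z q.1, (A n q.1, B n q.1)), q.2)) =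
        ((P.map Z).prod κ).prod ν := by
      have := Measure.map_prod_map P ν (hZm.prodMk (h.measurable_pair n)) measurable_id
      rw [Measure.map_id, hjoint] at this
      exact this.symm
    -- Stationarity enters here: the terminal value `x` may be replaced by `A_n x + B_n` with a
    -- fresh pair, without changing the joint law with the past.
    have e3 : (P.map Z).prod ν = (((P.map Z).prod κ).prod ν).map
        (fun q : ((ℝ × ℝ) × (ℝ × ℝ)) × ℝ => (q.1.1, q.1.2.1 * q.2 + q.1.2.2)) := by
      conv_lhs => rw [← hν, ← Measure.map_id (μ := P.map Z)]
      rw [Measure.map_prod_map _ _ measurable_id (by fun_prop), ← Measure.prodAssoc_prod,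
        Measure.map_map (by fun_prop) (by fun_prop)]
      rfl
    have hpm : Measurable (fun q : Ω × ℝ => ((Z q.1, (A n q.1, B n q.1)), q.2)) :=
      ((hZm.prodMk (h.measurable_pair n)).comp measurable_fst).prodMk measurable_snd
    calc _ = ((P.prod ν).map (fun q : Ω × ℝ => ((Z q.1, (A n q.1, B n q.1)), q.2))).map
          ((fun r : (ℝ × ℝ) × ℝ => r.1.1 + r.1.2 * r.2) ∘
          (fun q : ((ℝ × ℝ) × (ℝ × ℝ)) × ℝ => (q.1.1, q.1.2.1 * q.2 + q.1.2.2))) := by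
          rw [Measure.map_map (by fun_prop) hpm]
          congr 1
          ext q
          simp only [perpetuitySum_succ, Finset.prod_range_succ, Function.comp, hZ]
          ring
      _ = ν := by
          have hqm : Measurable (fun q : Ω × ℝ => (Z q.1, q.2)) :=
            (hZm.comp measurable_fst).prodMk measurable_snd
          rw [e2, ← Measure.map_map (by fun_prop) (by fun_prop), ← e3, ← e1,
            Measure.map_map (by fun_prop) hqm]
          exact ih

end IsIIDPairs

/-! ### Stationarity, uniqueness and weak convergence -/

namespace IsIIDPairs

variable {Ω : Type*} [MeasurableSpace Ω] {P : Measure Ω} [IsProbabilityMeasure P]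
  {κ : Measure (ℝ × ℝ)} {A B : ℕ → Ω → ℝ}

omit [IsProbabilityMeasure P] in
theorem tendsto_perpetuitySum
    (hS : ∀ᵐ ω ∂P, Summable (fun k => perpetuityTerm A B k ω)) :
    ∀ᵐ ω ∂P, Tendsto (fun n => perpetuitySum A B n ω) atTop (𝓝 (perpetuity A B ω)) := by
  filter_upwards [hS] with ω hω using hω.hasSum.tendsto_sum_nat

omit [IsProbabilityMeasure P] in
theorem aemeasurable_perpetuity (h : IsIIDPairs P κ A B)
    (hS : ∀ᵐ ω ∂P, Summable (fun k => perpetuityTerm A B k ω)) :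
    AEMeasurable (perpetuity A B) P :=
  aemeasurable_of_tendsto_metrizable_ae atTop
    (fun n => (h.measurable_perpetuitySum n).aemeasurable) (tendsto_perpetuitySum hS)

/-- Both sides are laws of a.s. limits: `A S_n + B`, with `S_n` taken on a second copy of `Ω`, has
the law of `S_{n+1}` for every `n`. -/
theorem isStationaryLaw_perpetuity (h : IsIIDPairs P κ A B)
    (hS : ∀ᵐ ω ∂P, Summable (fun k => perpetuityTerm A B k ω)) :
    IsStationaryLaw κ (P.map (perpetuity A B)) := by
  have hlim := tendsto_perpetuitySum hS
  have hX := h.aemeasurable_perpetuity hS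
  have key : ∀ Y : Ω → ℝ, AEMeasurable Y P → affineLaw κ (P.map Y) =
      (P.prod P).map (fun q : Ω × Ω => A 0 q.1 * Y q.2 + B 0 q.1) := by
    intro Y hY
    have : IsProbabilityMeasure (P.map Y) := Measure.isProbabilityMeasure_map hY
    have h1 : (P.prod P).map (fun q : Ω × Ω => ((A 0 q.1, B 0 q.1), Y q.2)) =
        κ.prod (P.map Y) := by
      have h2 : P.map Y = P.map (hY.mk Y) := Measure.map_congr hY.ae_eq_mk
      rw [h2, ← h.law 0, Measure.map_prod_map _ _ (h.measurable_pair 0) hY.measurable_mk]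
      refine Measure.map_congr ?_
      filter_upwards [Measure.quasiMeasurePreserving_snd.ae_eq_comp (μ := P.prod P) (ν := P)
        hY.ae_eq_mk] with q hq
      simp only [Function.comp] at hq
      simp [hq, Prod.map]
    have h3 : AEMeasurable (fun q : Ω × Ω => ((A 0 q.1, B 0 q.1), Y q.2)) (P.prod P) :=
      ((h.measurable_pair 0).comp measurable_fst).aemeasurable.prodMk
        (hY.comp_quasiMeasurePreserving Measure.quasiMeasurePreserving_snd)
    rw [affineLaw, ← h1, AEMeasurable.map_map_of_aemeasurable (by fun_prop) h3]
    rfl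
  change affineLaw κ _ = _
  rw [key _ hX]
  have hm : ∀ n, Measurable (fun q : Ω × Ω => A 0 q.1 * perpetuitySum A B n q.2 + B 0 q.1) :=
    fun n => (((h.measurable_A 0).comp measurable_fst).mul
      ((h.measurable_perpetuitySum n).comp measurable_snd)).add
      ((h.measurable_B 0).comp measurable_fst)
  refine map_eq_of_tendsto_ae hm (fun n => h.measurable_perpetuitySum (n + 1)) ?_ ?_ ?_
  · filter_upwards [Measure.quasiMeasurePreserving_snd.ae hlim] with q hq
    exact (hq.const_mul _).add_const _
  · filter_upwards [hlim] with ω hω using hω.comp (tendsto_add_atTop_nat 1)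
  · intro n
    rw [h.map_perpetuitySum_succ, key _ (h.measurable_perpetuitySum n).aemeasurable]

/-- `S_n + Π_n x` has law `ν` for every `n` and converges a.s. to the perpetuity, as `Π_n → 0`. -/
theorem eq_map_perpetuity_of_isStationaryLaw (h : IsIIDPairs P κ A B)
    (hS : ∀ᵐ ω ∂P, Summable (fun k => perpetuityTerm A B k ω))
    (hprod : ∀ᵐ ω ∂P, Tendsto (fun n => ∏ j ∈ Finset.range n, A j ω) atTop (𝓝 0))
    {ν : Measure ℝ} [IsProbabilityMeasure ν] (hν : IsStationaryLaw κ ν) :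
    ν = P.map (perpetuity A B) := by
  have hX := h.aemeasurable_perpetuity hS
  have hm : ∀ n, Measurable (fun q : Ω × ℝ =>
      perpetuitySum A B n q.1 + (∏ j ∈ Finset.range n, A j q.1) * q.2) := fun n =>
    ((h.measurable_perpetuitySum n).comp measurable_fst).add
      (((h.measurable_prod_range n).comp measurable_fst).mul measurable_snd)
  have h1 : (P.prod ν).map (fun q : Ω × ℝ => perpetuity A B q.1) = ν.map (fun x => x) := by
    refine map_eq_of_tendsto_ae (Z' := fun _ x => x) hm (fun _ => measurable_id) ?_
      (Eventually.of_forall fun x => tendsto_const_nhds) ?_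
    · filter_upwards [Measure.quasiMeasurePreserving_fst.ae (tendsto_perpetuitySum hS),
        Measure.quasiMeasurePreserving_fst.ae hprod] with q hq hq'
      simpa using hq.add (hq'.mul_const q.2)
    · intro n
      rw [h.map_perpetuitySum_add_of_isStationaryLaw hν n]
      exact Measure.map_id.symm
  have h2 : (P.prod ν).map (fun q : Ω × ℝ => perpetuity A B q.1) = P.map (perpetuity A B) := by
    have h3 := AEMeasurable.map_map_of_aemeasurable (μ := P.prod ν) (f := Prod.fst)
      (g := perpetuity A B) (by simpa using hX) measurable_fst.aemeasurable
    simp only [Measure.map_fst_prod, measure_univ, one_smul] at h3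
    exact h3.symm
  rw [← h2, h1]
  exact Measure.map_id.symm

omit [MeasurableSpace Ω] in
theorem affineChain_eq_add (X₀ : Ω → ℝ) (n : ℕ) (ω : Ω) :
    affineChain A B X₀ n ω =
      affineChain A B (fun _ => 0) n ω + (∏ j ∈ Finset.range n, A j ω) * X₀ ω := by
  induction n with
  | zero => simp [affineChain]
  | succ n ih =>
    simp only [affineChain, ih, Finset.prod_range_succ]
    ring

/-- The chains started at `X₀` and at `0` differ by `Π_n X₀`, which tends to `0` a.s. -/
theorem tendstoInDistribution_affineChain (h : IsIIDPairs P κ A B)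
    (hS : ∀ᵐ ω ∂P, Summable (fun k => perpetuityTerm A B k ω))
    (hprod : ∀ᵐ ω ∂P, Tendsto (fun n => ∏ j ∈ Finset.range n, A j ω) atTop (𝓝 0))
    {X₀ : Ω → ℝ} (hX₀ : Measurable X₀) :
    TendstoInDistribution (affineChain A B X₀) atTop (perpetuity A B) (fun _ => P) P := by
  have hcm : ∀ {Y : Ω → ℝ}, Measurable Y → ∀ n, Measurable (affineChain A B Y n) :=
    fun hY n => measurable_affineChain hY (fun _ _ => h.measurable_A _)
      (fun _ _ => h.measurable_B _)
  have h0 : TendstoInDistribution (affineChain A B (fun _ => 0)) atTop (perpetuity A B)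
      (fun _ => P) P := by
    have hd := (tendstoInMeasure_of_tendsto_ae
      (fun n => (h.measurable_perpetuitySum n).aestronglyMeasurable)
      (tendsto_perpetuitySum hS)).tendstoInDistribution
      (fun n => (h.measurable_perpetuitySum n).aemeasurable)
    refine ⟨fun n => (hcm measurable_const n).aemeasurable, hd.aemeasurable_limit, ?_⟩
    have h1 := hd.tendsto
    simp only [h.map_perpetuitySum] at h1
    simp only [h.map_affineChain_zero]
    exact h1
  refine tendstoInDistribution_of_tendstoInMeasure_sub _ _ h0 ?_
    (fun n => (hcm hX₀ n).aemeasurable)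
  refine tendstoInMeasure_of_tendsto_ae
    (fun n => ((hcm hX₀ n).sub (hcm measurable_const n)).aestronglyMeasurable) ?_
  filter_upwards [hprod] with ω hω
  have : (fun n => (affineChain A B X₀ - affineChain A B fun _ => 0) n ω) =
      fun n => (∏ j ∈ Finset.range n, A j ω) * X₀ ω := by
    ext n
    simp only [Pi.sub_apply]
    rw [affineChain_eq_add X₀ n ω]
    ring
  rw [this]
  simpa using hω.mul_const (X₀ ω)

/-! ### Fractional moments and absolute convergence -/

/-- The moments of the products `A 0 ⋯ A (n - 1)`. -/
theorem lintegral_enorm_prod_rpow (h : IsIIDPairs P κ A B) (δ : ℝ) (hδ : 0 ≤ δ) (n : ℕ) :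
    ∫⁻ ω, ‖∏ j ∈ Finset.range n, A j ω‖ₑ ^ δ ∂P = (∫⁻ p, ‖p.1‖ₑ ^ δ ∂κ) ^ n := by
  induction n with
  | zero => simp
  | succ n ih =>
    have hind : IndepFun (fun ω => ‖∏ j ∈ Finset.range n, A j ω‖ₑ ^ δ)
        (fun ω => ‖A n ω‖ₑ ^ δ) P :=
      (h.indepFun_past_pair n).comp (φ := fun p : ℝ × ℝ => ‖p.2‖ₑ ^ δ) (ψ := fun p : ℝ × ℝ => ‖p.1‖ₑ ^ δ)
        (by fun_prop) (by fun_prop)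
    have hA := h.measurable_A n
    have hP := h.measurable_prod_range n
    have hlaw : ∫⁻ ω, ‖A n ω‖ₑ ^ δ ∂P = ∫⁻ p, ‖p.1‖ₑ ^ δ ∂κ := by
      rw [← h.law n, lintegral_map (by fun_prop) (h.measurable_pair n)]
    rw [pow_succ, ← ih, ← hlaw, ← lintegral_mul_eq_lintegral_mul_lintegral_of_indepFun''
      (hP.enorm.pow_const δ).aemeasurable (by fun_prop) hind]
    simp only [Finset.prod_range_succ, enorm_mul, ENNReal.mul_rpow_of_nonneg _ _ hδ]

theorem lintegral_enorm_perpetuityTerm_rpow (h : IsIIDPairs P κ A B) (δ : ℝ) (hδ : 0 ≤ δ)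
    (n : ℕ) : ∫⁻ ω, ‖perpetuityTerm A B n ω‖ₑ ^ δ ∂P =
      (∫⁻ p, ‖p.1‖ₑ ^ δ ∂κ) ^ n * ∫⁻ p, ‖p.2‖ₑ ^ δ ∂κ := by
  have hind : IndepFun (fun ω => ‖∏ j ∈ Finset.range n, A j ω‖ₑ ^ δ)
      (fun ω => ‖B n ω‖ₑ ^ δ) P :=
    (h.indepFun_past_pair n).comp (φ := fun p : ℝ × ℝ => ‖p.2‖ₑ ^ δ) (ψ := fun p : ℝ × ℝ => ‖p.2‖ₑ ^ δ)
      (by fun_prop) (by fun_prop)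
  have hB := h.measurable_B n
  have hP := h.measurable_prod_range n
  have hlaw : ∫⁻ ω, ‖B n ω‖ₑ ^ δ ∂P = ∫⁻ p, ‖p.2‖ₑ ^ δ ∂κ := by
    rw [← h.law n, lintegral_map (by fun_prop) (h.measurable_pair n)]
  rw [← h.lintegral_enorm_prod_rpow δ hδ, ← hlaw,
    ← lintegral_mul_eq_lintegral_mul_lintegral_of_indepFun''
      (hP.enorm.pow_const δ).aemeasurable (by fun_prop) hind]
  simp only [perpetuityTerm, enorm_mul, ENNReal.mul_rpow_of_nonneg _ _ hδ, mul_comm]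

end IsIIDPairs

/-- A sequence in `ℓ^δ`, `0 < δ ≤ 1`, is summable. -/
theorem summable_of_tsum_enorm_rpow_ne_top {x : ℕ → ℝ} {δ : ℝ} (hδ : 0 < δ) (hδ1 : δ ≤ 1)
    (h : ∑' k, ‖x k‖ₑ ^ δ ≠ ∞) : Summable x := by
  refine Summable.of_norm_bounded_eventually (ENNReal.summable_toReal h) ?_
  have h0 := (ENNReal.tendsto_cofinite_zero_of_tsum_ne_top h).eventually
    (gt_mem_nhds zero_lt_one)
  filter_upwards [h0] with k hk
  have h1 : ‖x k‖ₑ ≤ 1 := by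
    by_contra! hc
    exact absurd hk (not_lt.2 (ENNReal.one_le_rpow hc.le hδ))
  have h2 : ‖x k‖ₑ ≤ ‖x k‖ₑ ^ δ := by
    conv_lhs => rw [← ENNReal.rpow_one ‖x k‖ₑ]
    exact ENNReal.rpow_le_rpow_of_exponent_ge h1 hδ1
  have h3 := ENNReal.toReal_mono (hk.ne_top) h2
  simpa using h3

namespace IsIIDPairs

variable {Ω : Type*} [MeasurableSpace Ω] {P : Measure Ω} [IsProbabilityMeasure P]
  {κ : Measure (ℝ × ℝ)} {A B : ℕ → Ω → ℝ}

theorem summable_perpetuityTerm (h : IsIIDPairs P κ A B) {δ : ℝ} (hδ : 0 < δ) (hδ1 : δ ≤ 1)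
    (hA : ∫⁻ p, ‖p.1‖ₑ ^ δ ∂κ < 1) (hB : ∫⁻ p, ‖p.2‖ₑ ^ δ ∂κ ≠ ∞) :
    ∀ᵐ ω ∂P, Summable (fun k => perpetuityTerm A B k ω) := by
  have hm : ∀ k, Measurable (fun ω => ‖perpetuityTerm A B k ω‖ₑ ^ δ) := fun k =>
    (((h.measurable_B k).mul (h.measurable_prod_range k)).enorm).pow_const δ
  have hfin : ∫⁻ ω, ∑' k, ‖perpetuityTerm A B k ω‖ₑ ^ δ ∂P ≠ ∞ := by
    rw [lintegral_tsum fun k => (hm k).aemeasurable]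
    simp only [h.lintegral_enorm_perpetuityTerm_rpow δ hδ.le]
    rw [ENNReal.tsum_mul_right, ENNReal.tsum_geometric]
    exact ENNReal.mul_ne_top (by simpa [tsub_eq_zero_iff_le] using hA) hB
  filter_upwards [ae_lt_top (Measurable.tsum hm) hfin] with ω hω
  exact summable_of_tsum_enorm_rpow_ne_top hδ hδ1 hω.ne

theorem tendsto_prod_range_zero (h : IsIIDPairs P κ A B) {δ : ℝ} (hδ : 0 < δ) (hδ1 : δ ≤ 1)
    (hA : ∫⁻ p, ‖p.1‖ₑ ^ δ ∂κ < 1) :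
    ∀ᵐ ω ∂P, Tendsto (fun n => ∏ j ∈ Finset.range n, A j ω) atTop (𝓝 0) := by
  have hm : ∀ k, Measurable (fun ω => ‖∏ j ∈ Finset.range k, A j ω‖ₑ ^ δ) := fun k =>
    (h.measurable_prod_range k).enorm.pow_const δ
  have hfin : ∫⁻ ω, ∑' k, ‖∏ j ∈ Finset.range k, A j ω‖ₑ ^ δ ∂P ≠ ∞ := by
    rw [lintegral_tsum fun k => (hm k).aemeasurable]
    simp only [h.lintegral_enorm_prod_rpow δ hδ.le]
    rw [ENNReal.tsum_geometric]
    simpa [tsub_eq_zero_iff_le] using hA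
  filter_upwards [ae_lt_top (Measurable.tsum hm) hfin] with ω hω
  exact (summable_of_tsum_enorm_rpow_ne_top hδ hδ1 hω.ne).tendsto_atTop_zero

end IsIIDPairs

/-! ### Tails of `A`, of `B` and of products of two copies of `A` -/

section Tails

variable {Ω : Type*} [MeasurableSpace Ω] {P : Measure Ω} [IsProbabilityMeasure P]
  {a b : Ω → ℝ} {α : ℝ}

/-- The tail `t ↦ P(a > t)` is regularly varying of index `-α`. -/
def RegularlyVaryingTail (P : Measure Ω) (a : Ω → ℝ) (α : ℝ) : Prop :=
  ∀ y : ℝ, 0 < y →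
    AsympEq (fun t => P.real {ω | t * y < a ω}) (fun t => y ^ (-α) * P.real {ω | t < a ω})

theorem tail_antitone (P : Measure Ω) [IsProbabilityMeasure P] (a : Ω → ℝ) :
    Antitone (fun t => P.real {ω | t < a ω}) := fun s t hst =>
  measureReal_mono fun ω (hω : t < a ω) => hst.trans_lt hω

theorem RegularlyVaryingTail.tail_pos (h : RegularlyVaryingTail P a α) (t : ℝ) :
    0 < P.real {ω | t < a ω} := by
  have h1 : Tendsto _ _ _ := h 1 one_pos
  obtain ⟨s, hs, hts⟩ := ((h1.eventually_ne one_ne_zero).and (eventually_ge_atTop t)).exists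
  refine lt_of_lt_of_le ?_ (tail_antitone P a hts)
  -- A zero tail at `s` would make the quotient `0`, since `x / 0 = 0`.
  refine lt_of_le_of_ne measureReal_nonneg fun h0 => hs ?_
  simp [← h0]

theorem RegularlyVaryingTail.tendsto_ratio (h : RegularlyVaryingTail P a α) {y : ℝ}
    (hy : 0 < y) : Tendsto (fun t => P.real {ω | t * y < a ω} / P.real {ω | t < a ω}) atTop
      (𝓝 (y ^ (-α))) := by
  have h1 : Tendsto _ _ _ := h y hy
  have h2 := h1.const_mul (y ^ (-α))
  rw [mul_one] at h2
  refine h2.congr fun t => ?_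
  have := (h.tail_pos t).ne'
  have := (Real.rpow_pos_of_pos hy (-α)).ne'
  field_simp

theorem tendsto_tail_zero (ha : Measurable a) :
    Tendsto (fun t => P.real {ω | t < a ω}) atTop (𝓝 0) := by
  have h : Tendsto (fun t => ∫ ω, Set.indicator {ω | t < a ω} (fun _ => (1 : ℝ)) ω ∂P) atTop
      (𝓝 (∫ _, 0 ∂P)) := by
    refine tendsto_integral_filter_of_dominated_convergence (fun _ => 1)
      (Eventually.of_forall fun t => ?_) (Eventually.of_forall fun t => ?_)
      (integrable_const _) ?_
    · exact (measurable_const.indicator (measurableSet_lt measurable_const ha)).aestronglyMeasurable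
    · refine Eventually.of_forall fun ω => ?_
      by_cases hω : t < a ω <;> simp [Set.indicator, hω]
    · refine Eventually.of_forall fun ω => tendsto_const_nhds.congr' ?_
      filter_upwards [eventually_ge_atTop (a ω)] with t ht
      simp [Set.indicator, not_lt.2 ht]
  simp only [integral_zero] at h
  refine h.congr fun t => ?_
  rw [integral_indicator_const _ (measurableSet_lt measurable_const ha)]
  simp

theorem exists_tail_le_mul (hpos : ∀ t, 0 < P.real {ω | t < a ω})
    (h : limsup (fun t : ℝ => P {ω | t < |b ω|} / P {ω | t < a ω}) atTop < ∞) :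
    ∃ C : ℝ≥0∞, C ≠ ∞ ∧ ∀ t, P {ω | t < |b ω|} ≤ C * P {ω | t < a ω} := by
  have hpos' : ∀ t, P {ω | t < a ω} ≠ 0 := fun t ht => by simpa [Measure.real, ht] using hpos t
  obtain ⟨C, hC, hC'⟩ := exists_between h
  obtain ⟨T, hT⟩ := eventually_atTop.1 (eventually_lt_of_limsup_lt hC)
  -- `C` serves for `t ≥ T`; the second summand makes the right side at least `1` for `t ≤ T`.
  refine ⟨C + (P {ω | T < a ω})⁻¹, ENNReal.add_ne_top.2
    ⟨hC'.ne, ENNReal.inv_ne_top.2 (hpos' T)⟩, fun t => ?_⟩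
  rcases le_total T t with ht | ht
  · refine le_trans ?_ (mul_le_mul_left le_self_add _)
    exact ((ENNReal.div_le_iff (hpos' t) (measure_ne_top _ _)).1 (hT t ht).le)
  · refine le_trans ?_ (mul_le_mul_left le_add_self _)
    calc P {ω | t < |b ω|} ≤ 1 := prob_le_one
      _ = (P {ω | T < a ω})⁻¹ * P {ω | T < a ω} :=
        (ENNReal.inv_mul_cancel (hpos' T) (measure_ne_top _ _)).symm
      _ ≤ _ := mul_le_mul_right (measure_mono fun ω (hω : T < a ω) => ht.trans_lt hω) _

omit [IsProbabilityMeasure P] in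
theorem lintegral_enorm_rpow_le_of_tail_le (ha : Measurable a) (hb : Measurable b)
    (ha0 : ∀ᵐ ω ∂P, 0 < a ω) {C : ℝ≥0∞}
    (h : ∀ t, P {ω | t < |b ω|} ≤ C * P {ω | t < a ω}) {δ : ℝ} (hδ : 0 < δ) :
    ∫⁻ ω, ‖b ω‖ₑ ^ δ ∂P ≤ C * ∫⁻ ω, ‖a ω‖ₑ ^ δ ∂P := by
  have e1 : ∫⁻ ω, ‖b ω‖ₑ ^ δ ∂P = ∫⁻ ω, ENNReal.ofReal (|b ω| ^ δ) ∂P := by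
    refine lintegral_congr fun ω => ?_
    rw [← ENNReal.ofReal_rpow_of_nonneg (abs_nonneg _) hδ.le, ← Real.norm_eq_abs, ofReal_norm]
  have e2 : ∫⁻ ω, ‖a ω‖ₑ ^ δ ∂P = ∫⁻ ω, ENNReal.ofReal (a ω ^ δ) ∂P := by
    refine lintegral_congr_ae ?_
    filter_upwards [ha0] with ω hω
    rw [← ENNReal.ofReal_rpow_of_nonneg hω.le hδ.le, Real.enorm_of_nonneg hω.le]
  rw [e1, e2, lintegral_rpow_eq_lintegral_meas_lt_mul P
      (Eventually.of_forall fun ω => abs_nonneg (b ω)) hb.abs.aemeasurable hδ,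
    lintegral_rpow_eq_lintegral_meas_lt_mul P (ha0.mono fun ω h => h.le) ha.aemeasurable hδ,
    mul_left_comm]
  refine mul_le_mul_right ?_ _
  have hmt : Measurable (fun t : ℝ => P {ω | t < a ω}) :=
    Antitone.measurable fun s t hst => measure_mono fun ω (hω : t < a ω) => hst.trans_lt hω
  have hmt' : Measurable (fun t : ℝ => P {ω | t < a ω} * ENNReal.ofReal (t ^ (δ - 1))) :=
    hmt.mul (by fun_prop)
  rw [← lintegral_const_mul _ hmt']
  refine lintegral_mono fun t => ?_
  rw [← mul_assoc]
  exact mul_le_mul_left (h t) _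

/-- Bernoulli's inequality: `a^δ = (a^α)^r ≤ 1 + r (a^α - 1)` with `r = δ / α ∈ (0, 1]`, and the
right side has mean below `1`. -/
theorem lintegral_enorm_rpow_lt_one (ha0 : ∀ᵐ ω ∂P, 0 < a ω)
    (hint : Integrable (fun ω => a ω ^ α) P) (hm : ∫ ω, a ω ^ α ∂P < 1) {δ : ℝ} (hδ : 0 < δ)
    (hδα : δ ≤ α) : ∫⁻ ω, ‖a ω‖ₑ ^ δ ∂P < 1 := by
  have hα : 0 < α := hδ.trans_le hδα
  set r := δ / α with hr
  have hr0 : 0 < r := div_pos hδ hα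
  have hr1 : r ≤ 1 := (div_le_one hα).2 hδα
  have hint' : Integrable (fun ω => 1 + r * (a ω ^ α - 1)) P :=
    (integrable_const _).add ((hint.sub (integrable_const _)).const_mul _)
  have hle : ∀ᵐ ω ∂P, 0 ≤ a ω ^ δ ∧ a ω ^ δ ≤ 1 + r * (a ω ^ α - 1) := by
    filter_upwards [ha0] with ω hω
    refine ⟨(Real.rpow_pos_of_pos hω _).le, ?_⟩
    have := rpow_one_add_le_one_add_mul_self (s := a ω ^ α - 1)
      (by linarith [Real.rpow_pos_of_pos hω α]) hr0.le hr1
    rwa [add_sub_cancel, ← Real.rpow_mul hω.le, hr, mul_div_cancel₀ _ hα.ne'] at this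
  calc ∫⁻ ω, ‖a ω‖ₑ ^ δ ∂P ≤ ∫⁻ ω, ENNReal.ofReal (1 + r * (a ω ^ α - 1)) ∂P := by
        refine lintegral_mono_ae ?_
        filter_upwards [ha0, hle] with ω hω h
        rw [Real.enorm_of_nonneg hω.le, ENNReal.ofReal_rpow_of_nonneg hω.le hδ.le]
        exact ENNReal.ofReal_le_ofReal h.2
    _ = ENNReal.ofReal (∫ ω, 1 + r * (a ω ^ α - 1) ∂P) :=
        (ofReal_integral_eq_lintegral_ofReal hint' (hle.mono fun ω h => h.1.trans h.2)).symm
    _ < 1 := by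
        have hint₁ : Integrable (fun ω => a ω ^ α - 1) P := hint.sub (integrable_const _)
        rw [ENNReal.ofReal_lt_one, integral_add (integrable_const _) (hint₁.const_mul _),
          integral_const_mul, integral_sub hint (integrable_const _)]
        simp only [integral_const, probReal_univ, smul_eq_mul, mul_one]
        nlinarith

/-- Breiman-type asymptotics for the tail of a product with one bounded factor. -/
theorem RegularlyVaryingTail.tendsto_prod_tail_le (h : RegularlyVaryingTail P a α)
    (ha : Measurable a) (ha0 : ∀ᵐ ω ∂P, 0 < a ω) {K : ℝ} (hK : 0 < K) :
    Tendsto (fun t => (P.prod P).real {p : Ω × Ω | t < a p.1 * a p.2 ∧ a p.2 ≤ K} /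
      P.real {ω | t < a ω}) atTop (𝓝 (∫ ω in {ω | a ω ≤ K}, a ω ^ α ∂P)) := by
  set S : ℝ → Set (Ω × Ω) := fun t => {p : Ω × Ω | t < a p.1 * a p.2 ∧ a p.2 ≤ K} with hS
  have hSm : ∀ t, MeasurableSet (S t) := fun t =>
    (measurableSet_lt (f := fun _ : Ω × Ω => t) (g := fun p => a p.1 * a p.2)
      measurable_const (by fun_prop)).inter
      (measurableSet_le (f := fun p : Ω × Ω => a p.2) (by fun_prop) measurable_const)
  have hKm : MeasurableSet {ω | a ω ≤ K} := measurableSet_le ha measurable_const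
  have hint : ∀ t, (P.prod P).real (S t) / P.real {ω | t < a ω} =
      ∫ y, P.real ((fun x => (x, y)) ⁻¹' S t) / P.real {ω | t < a ω} ∂P := by
    intro t
    rw [integral_div]
    congr 1
    simp only [Measure.real]
    rw [Measure.prod_apply_symm (hSm t), integral_toReal
      (measurable_measure_prodMk_right (hSm t)).aemeasurable
      (Eventually.of_forall fun _ => measure_lt_top _ _)]
  change Tendsto (fun t => (P.prod P).real (S t) / P.real {ω | t < a ω}) _ _
  simp only [hint]
  rw [← integral_indicator hKm]
  -- Domination: when `a y ≤ K`, the integrand is at most `P(a > t / K) / P(a > t)`, which converges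
  -- and so is eventually bounded.
  have hratio := h.tendsto_ratio (inv_pos.2 hK)
  have hbd := hratio.eventually (gt_mem_nhds (lt_add_one (K⁻¹ ^ (-α))))
  refine tendsto_integral_filter_of_dominated_convergence (fun _ => K⁻¹ ^ (-α) + 1)
    (Eventually.of_forall fun t => ?_) ?_ (integrable_const _) ?_
  · exact ((measurable_measure_prodMk_right (hSm t)).ennreal_toReal.div_const _).aestronglyMeasurable
  · filter_upwards [hbd, eventually_ge_atTop 0] with t ht ht0
    filter_upwards [ha0] with y hy
    rw [Real.norm_of_nonneg (div_nonneg measureReal_nonneg measureReal_nonneg)]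
    refine le_trans ?_ ht.le
    refine div_le_div_of_nonneg_right (measureReal_mono ?_) measureReal_nonneg
    rintro x ⟨hx1, hx2⟩
    have hx1 : t < a x * a y := hx1
    have hx2 : a y ≤ K := hx2
    have hax : 0 < a x := by
      by_contra! hc
      nlinarith
    change t * K⁻¹ < a x
    rw [← div_eq_mul_inv, div_lt_iff₀ hK]
    exact hx1.trans_le (mul_le_mul_of_nonneg_left hx2 hax.le)
  · filter_upwards [ha0] with y hy
    by_cases hyK : a y ≤ K
    · have h1 := h.tendsto_ratio (inv_pos.2 hy)
      have e : (a y)⁻¹ ^ (-α) = a y ^ α := by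
        rw [Real.inv_rpow hy.le, Real.rpow_neg hy.le, inv_inv]
      rw [e] at h1
      simp only [Set.indicator, Set.mem_ofPred_eq, hyK, if_true]
      refine h1.congr fun t => ?_
      congr 2
      ext x
      simp only [hS, Set.mem_ofPred_eq, Set.mem_preimage, hyK, and_true]
      rw [← div_eq_mul_inv, div_lt_iff₀ hy]
    · simp [Set.indicator, hyK, hS]

/-- The contribution of large values of both factors to the tail of a product. -/
theorem RegularlyVaryingTail.exists_prod_tail_le (h : RegularlyVaryingTail P a α)
    (ha : Measurable a) (ha0 : ∀ᵐ ω ∂P, 0 < a ω)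
    (hint : Integrable (fun ω => a ω ^ α) P) (hm : ∫ ω, a ω ^ α ∂P < 1)
    (hconv : AsympEq (fun t => (P.prod P).real {p : Ω × Ω | t < a p.1 * a p.2})
      (fun t => 2 * (∫ ω, a ω ^ α ∂P) * P.real {ω | t < a ω})) :
    ∃ K d q : ℝ, 0 < d ∧ d < 1 ∧ 0 < q ∧ q < 1 ∧ ∀ᶠ t in atTop,
      (P.prod P).real {p : Ω × Ω | (1 - d) * t < a p.1 * a p.2 ∧ K < a p.2} ≤
        q * P.real {ω | t < a ω} := by
  set m := ∫ ω, a ω ^ α ∂P with hm_def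
  have hm0 : 0 < m := by
    refine (integral_pos_iff_support_of_nonneg_ae
      (ha0.mono fun ω h => (Real.rpow_pos_of_pos h _).le) hint).2 ?_
    refine pos_iff_ne_zero.2 fun h0 => ?_
    have h1 : ∀ᵐ ω ∂P, False := by
      filter_upwards [ha0, measure_eq_zero_iff_ae_notMem.1 h0] with ω hω hω'
      exact hω' (Real.rpow_pos_of_pos hω _).ne'
    obtain ⟨ω, hω⟩ := h1.exists
    exact hω
  have hL : Tendsto (fun n : ℕ => ∫ ω in {ω | a ω ≤ n}, a ω ^ α ∂P) atTop (𝓝 m) := by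
    have hU : (⋃ n : ℕ, {ω | a ω ≤ n}) = Set.univ :=
      Set.eq_univ_of_forall fun ω => Set.mem_iUnion.2 (exists_nat_ge (a ω))
    have := tendsto_setIntegral_of_monotone (μ := P) (f := fun ω => a ω ^ α)
      (s := fun n : ℕ => {ω | a ω ≤ n}) (fun n => measurableSet_le ha measurable_const)
      (fun i j hij ω (hω : a ω ≤ i) => hω.trans (by exact_mod_cast hij))
      (hint.integrableOn)
    rwa [hU, setIntegral_univ] at this
  -- Since `m < 1`, the truncated moment `L` can be taken so near `m` that `2m - L < 1`.
  obtain ⟨N, hN, hN1⟩ := ((hL.eventually (lt_mem_nhds (show 2 * m - 1 < m by linarith))).and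
    (eventually_ge_atTop 1)).exists
  have hN0 : (0 : ℝ) < N := by exact_mod_cast hN1
  set L := ∫ ω in {ω | a ω ≤ (N : ℝ)}, a ω ^ α ∂P with hL_def
  have hLm : L ≤ m := setIntegral_le_integral hint
    (ha0.mono fun ω h => (Real.rpow_pos_of_pos h _).le)
  have hcd : Tendsto (fun d : ℝ => (2 * m - L) * (1 - d) ^ (-α)) (𝓝[>] 0)
      (𝓝 (2 * m - L)) := by
    have : ContinuousAt (fun d : ℝ => (2 * m - L) * (1 - d) ^ (-α)) 0 :=
      continuousAt_const.mul ((continuousAt_const.sub continuousAt_id).rpow_const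
        (Or.inl (by norm_num)))
    simpa [ContinuousAt] using this.mono_left nhdsWithin_le_nhds
  -- Rescaling `t` to `(1 - d) t` costs a factor `(1 - d)^(-α)`; a small `d` keeps the product below
  -- `1`.
  obtain ⟨d, hd, hd0, hd1⟩ := ((hcd.eventually (gt_mem_nhds
    (show 2 * m - L < 1 by linarith))).and (Ioo_mem_nhdsGT zero_lt_one)).exists
  obtain ⟨q, hq, hq1⟩ := exists_between hd
  have hd' : 0 < 1 - d := by linarith
  refine ⟨N, d, q, hd0, hd1, lt_trans (mul_pos (by linarith) (Real.rpow_pos_of_pos hd' _)) hq,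
    hq1, ?_⟩
  have hfull : Tendsto (fun t => (P.prod P).real {p : Ω × Ω | t < a p.1 * a p.2} /
      P.real {ω | t < a ω}) atTop (𝓝 (2 * m)) := by
    have h1 : Tendsto _ _ _ := hconv
    have h2 := h1.const_mul (2 * m)
    rw [mul_one] at h2
    refine h2.congr fun t => ?_
    have := (h.tail_pos t).ne'
    field_simp
  have hdiff : Tendsto (fun t => (P.prod P).real {p : Ω × Ω | t < a p.1 * a p.2 ∧ N < a p.2} /
      P.real {ω | t < a ω}) atTop (𝓝 (2 * m - L)) := by
    refine (hfull.sub (h.tendsto_prod_tail_le ha ha0 hN0)).congr fun t => ?_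
    rw [← sub_div]
    congr 1
    have hmeas : MeasurableSet {p : Ω × Ω | a p.2 ≤ N} :=
      measurableSet_le (by fun_prop) measurable_const
    have := measureReal_inter_add_sdiff (μ := P.prod P)
      (s := {p : Ω × Ω | t < a p.1 * a p.2}) hmeas
    rw [← this]
    have e1 : {p : Ω × Ω | t < a p.1 * a p.2} ∩ {p : Ω × Ω | a p.2 ≤ N} =
        {p : Ω × Ω | t < a p.1 * a p.2 ∧ a p.2 ≤ N} := rfl
    have e2 : {p : Ω × Ω | t < a p.1 * a p.2} \ {p : Ω × Ω | a p.2 ≤ N} =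
        {p : Ω × Ω | t < a p.1 * a p.2 ∧ N < a p.2} := by
      ext p; simp
    rw [e1, e2, add_sub_cancel_left]
  have hscale : Tendsto (fun t : ℝ => (1 - d) * t) atTop atTop :=
    tendsto_id.const_mul_atTop hd'
  have hfin := (hdiff.comp hscale).mul (h.tendsto_ratio hd')
  filter_upwards [hfin.eventually (gt_mem_nhds hq)] with t ht
  simp only [Function.comp, mul_comm t (1 - d)] at ht
  rw [div_mul_div_cancel₀ (h.tail_pos _).ne', div_lt_iff₀ (h.tail_pos t)] at ht
  exact ht.le

/-- This is the inequality that closes the induction for the upper bound. The product term is at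
most `q G(t)` with `q < 1`, and the `b` term is at most `D G(t) G(t₀)`; `t₀` is chosen so that `D
G(t₀) < 1 - q`. -/
theorem RegularlyVaryingTail.exists_threshold (h : RegularlyVaryingTail P a α)
    (ha : Measurable a) (ha0 : ∀ᵐ ω ∂P, 0 < a ω)
    (hint : Integrable (fun ω => a ω ^ α) P) (hm : ∫ ω, a ω ^ α ∂P < 1)
    (hconv : AsympEq (fun t => (P.prod P).real {p : Ω × Ω | t < a p.1 * a p.2})
      (fun t => 2 * (∫ ω, a ω ^ α ∂P) * P.real {ω | t < a ω}))
    (hb : limsup (fun t : ℝ => P {ω | t < |b ω|} / P {ω | t < a ω}) atTop < ∞) :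
    ∃ d t₀ : ℝ, 0 < d ∧ d < 1 ∧ 0 ≤ t₀ ∧ ∀ t, t₀ ≤ t →
      (P.prod P) {p : Ω × Ω | (1 - d) * t < a p.1 * a p.2 ∧ t₀ < a p.2} +
        P {ω | d * t < |b ω|} * P {ω | t₀ < a ω} ≤ P {ω | t < a ω} := by
  obtain ⟨K, d, q, hd0, hd1, hq0, hq1, hK⟩ := h.exists_prod_tail_le ha ha0 hint hm hconv
  obtain ⟨C, hC, hbC⟩ := exists_tail_le_mul h.tail_pos hb
  have hbC' : ∀ t, P.real {ω | t < |b ω|} ≤ C.toReal * P.real {ω | t < a ω} := fun t => by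
    rw [Measure.real, Measure.real, ← ENNReal.toReal_mul]
    exact ENNReal.toReal_mono (ENNReal.mul_ne_top hC (measure_ne_top _ _)) (hbC t)
  set D := C.toReal * (d ^ (-α) + 1) with hD
  have hbD : ∀ᶠ t in atTop, P.real {ω | d * t < |b ω|} ≤ D * P.real {ω | t < a ω} := by
    filter_upwards [(h.tendsto_ratio hd0).eventually (gt_mem_nhds (lt_add_one (d ^ (-α))))]
      with t ht
    rw [div_lt_iff₀ (h.tail_pos t), mul_comm t d] at ht
    calc _ ≤ _ := hbC' _
      _ ≤ C.toReal * ((d ^ (-α) + 1) * P.real {ω | t < a ω}) :=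
        mul_le_mul_of_nonneg_left ht.le ENNReal.toReal_nonneg
      _ = _ := by rw [hD, mul_assoc]
  have hzero : ∀ᶠ t in atTop, D * P.real {ω | t < a ω} < 1 - q := by
    have := (tendsto_tail_zero (P := P) ha).const_mul D
    rw [mul_zero] at this
    exact this.eventually (gt_mem_nhds (by linarith))
  obtain ⟨T, hT⟩ := eventually_atTop.1 (hK.and hbD)
  obtain ⟨t₀, ht₀, ht₀0, ht₀K, ht₀T⟩ := (hzero.and ((eventually_ge_atTop 0).and
    ((eventually_ge_atTop K).and (eventually_ge_atTop T)))).exists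
  refine ⟨d, t₀, hd0, hd1, ht₀0, fun t ht => ?_⟩
  obtain ⟨h1, h2⟩ := hT t (ht₀T.trans ht)
  rw [← ENNReal.toReal_le_toReal (by finiteness) (by finiteness), ENNReal.toReal_add
    (by finiteness) (by finiteness), ENNReal.toReal_mul]
  change (P.prod P).real _ + P.real _ * P.real _ ≤ P.real _
  have h3 : (P.prod P).real {p : Ω × Ω | (1 - d) * t < a p.1 * a p.2 ∧ t₀ < a p.2} ≤
      q * P.real {ω | t < a ω} :=
    le_trans (measureReal_mono fun p hp => And.intro hp.1 (ht₀K.trans_lt hp.2)) h1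
  have h4 := mul_le_mul_of_nonneg_right h2 (h.tail_pos t₀).le
  nlinarith [h.tail_pos t, mul_le_mul_of_nonneg_left ht₀.le (h.tail_pos t).le]

end Tails

/-! ### Propagation of the upper bound -/

/-- The tail bound `P(|X| > t) ≤ P(a > t ∨ t₀) / P(a > t₀)` is preserved by `X ↦ a X + b`. -/
theorem affineLaw_tail_le {Ω : Type*} [MeasurableSpace Ω] {P : Measure Ω}
    [IsProbabilityMeasure P] {a b : Ω → ℝ} (ha : Measurable a) (hb : Measurable b)
    (ha0 : ∀ᵐ ω ∂P, 0 < a ω) {d t₀ : ℝ}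
    (h : ∀ t, t₀ ≤ t → (P.prod P) {p : Ω × Ω | (1 - d) * t < a p.1 * a p.2 ∧ t₀ < a p.2} +
        P {ω | d * t < |b ω|} * P {ω | t₀ < a ω} ≤ P {ω | t < a ω})
    {ν : Measure ℝ} [IsProbabilityMeasure ν]
    (hν : ∀ t, ν {x | t < |x|} * P {ω | t₀ < a ω} ≤ P {ω | max t t₀ < a ω}) (t : ℝ) :
    affineLaw (P.map fun ω => (a ω, b ω)) ν {x | t < |x|} * P {ω | t₀ < a ω} ≤
      P {ω | max t t₀ < a ω} := by
  have hab : Measurable (fun ω => (a ω, b ω)) := ha.prodMk hb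
  set κ := P.map fun ω => (a ω, b ω) with hκ
  have : IsProbabilityMeasure κ := Measure.isProbabilityMeasure_map hab.aemeasurable
  have hfm : Measurable (fun p : (ℝ × ℝ) × ℝ => p.1.1 * p.2 + p.1.2) := by fun_prop
  have : IsProbabilityMeasure (affineLaw κ ν) :=
    Measure.isProbabilityMeasure_map hfm.aemeasurable
  -- Below `t₀` the bound only says that a probability is at most `1`.
  rcases lt_or_ge t t₀ with ht | ht
  · rw [max_eq_right ht.le]
    exact mul_le_of_le_one_left zero_le prob_le_one
  rw [max_eq_left ht]
  refine le_trans ?_ (h t ht)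
  have hm1 : MeasurableSet {p : (ℝ × ℝ) × ℝ | (1 - d) * t < |p.1.1| * |p.2|} :=
    measurableSet_lt measurable_const (by fun_prop)
  have hm2 : MeasurableSet {p : ℝ × ℝ | d * t < |p.2|} :=
    measurableSet_lt measurable_const (by fun_prop)
  have hm3 : MeasurableSet {p : Ω × Ω | (1 - d) * t < a p.1 * a p.2 ∧ t₀ < a p.2} :=
    (measurableSet_lt (f := fun _ : Ω × Ω => (1 - d) * t) (g := fun p => a p.1 * a p.2)
      measurable_const (by fun_prop)).inter
      (measurableSet_lt (g := fun p : Ω × Ω => a p.2) measurable_const (by fun_prop))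
  have hsplit : affineLaw κ ν {x | t < |x|} ≤
      (κ.prod ν) {p : (ℝ × ℝ) × ℝ | (1 - d) * t < |p.1.1| * |p.2|} + P {ω | d * t < |b ω|} := by
    rw [affineLaw, Measure.map_apply hfm (measurableSet_lt measurable_const (by fun_prop))]
    have e : P {ω | d * t < |b ω|} = (κ.prod ν) ({p : ℝ × ℝ | d * t < |p.2|} ×ˢ Set.univ) := by
      rw [Measure.prod_prod, measure_univ, mul_one, hκ, Measure.map_apply hab hm2]
      rfl
    rw [e]
    refine le_trans (measure_mono ?_) (measure_union_le _ _)
    intro p (hp : t < |p.1.1 * p.2 + p.1.2|)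
    by_contra hc
    simp only [Set.mem_union, Set.mem_ofPred_eq, Set.mem_prod, Set.mem_univ, and_true, not_or,
      not_lt] at hc
    have := abs_add_le (p.1.1 * p.2) p.1.2
    rw [abs_mul] at this
    linarith [hc.1, hc.2]
  refine le_trans (mul_le_mul_left hsplit _) ?_
  rw [add_mul]
  refine add_le_add_left ?_ _
  have hm4 : Measurable (fun p : ℝ × ℝ =>
      ν (Prod.mk p ⁻¹' {p : (ℝ × ℝ) × ℝ | (1 - d) * t < |p.1.1| * |p.2|})) :=
    measurable_measure_prodMk_left hm1
  have hm5 : Measurable (fun ω =>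
      ν (Prod.mk (a ω, b ω) ⁻¹' {p : (ℝ × ℝ) × ℝ | (1 - d) * t < |p.1.1| * |p.2|})) :=
    hm4.comp hab
  rw [Measure.prod_apply hm1, Measure.prod_apply hm3, hκ, lintegral_map hm4 hab,
    ← lintegral_mul_const _ hm5]
  refine lintegral_mono_ae ?_
  filter_upwards [ha0] with ω hω
  -- Conditionally on `a ω`, the hypothesis at level `(1 - d) t / a ω` trades `|x|` for an
  -- independent copy of `a` exceeding `t₀`.
  convert! hν ((1 - d) * t / a ω) using 3
  · ext x
    simp [abs_of_pos hω, div_lt_iff₀ hω, mul_comm]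
  · ext ω'
    simp [div_lt_iff₀ hω, mul_comm]

/-- The bound holds for `S_0 = 0` and propagates to every `S_n` with the same constant. As `{x | t <
|x|}` is open, the portmanteau theorem carries it to the limit. -/
theorem IsIIDPairs.exists_perpetuity_tail_le {Ω : Type*} [MeasurableSpace Ω] {P : Measure Ω}
    [IsProbabilityMeasure P] {κ : Measure (ℝ × ℝ)} {A B : ℕ → Ω → ℝ} (hAB : IsIIDPairs P κ A B)
    (ha0 : ∀ᵐ ω ∂P, 0 < A 0 ω) (hpos : ∀ t, 0 < P.real {ω | t < A 0 ω})
    (hS : ∀ᵐ ω ∂P, Summable (fun k => perpetuityTerm A B k ω)) {d t₀ : ℝ} (ht₀ : 0 ≤ t₀)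
    (h : ∀ t, t₀ ≤ t →
      (P.prod P) {p : Ω × Ω | (1 - d) * t < A 0 p.1 * A 0 p.2 ∧ t₀ < A 0 p.2} +
        P {ω | d * t < |B 0 ω|} * P {ω | t₀ < A 0 ω} ≤ P {ω | t < A 0 ω}) :
    ∃ C : ℝ≥0∞, C ≠ ∞ ∧ ∀ t, t₀ ≤ t →
      P {ω | t < |perpetuity A B ω|} ≤ C * P {ω | t < A 0 ω} := by
  have hpos' : ∀ t, P {ω | t < A 0 ω} ≠ 0 := fun t ht => by
    simpa [Measure.real, ht] using hpos t
  have hn : ∀ n t, P.map (perpetuitySum A B n) {x | t < |x|} * P {ω | t₀ < A 0 ω} ≤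
      P {ω | max t t₀ < A 0 ω} := by
    intro n
    induction n with
    | zero =>
      intro t
      rw [hAB.map_perpetuitySum, Function.iterate_zero, id, Measure.dirac_apply]
      rcases lt_or_ge t 0 with ht | ht
      · rw [max_eq_right (ht.le.trans ht₀)]
        exact mul_le_of_le_one_left zero_le (by simp [ht])
      · simp [not_lt.2 ht]
    | succ n ih =>
      intro t
      have : IsProbabilityMeasure (P.map (perpetuitySum A B n)) :=
        Measure.isProbabilityMeasure_map (hAB.measurable_perpetuitySum n).aemeasurable
      rw [hAB.map_perpetuitySum_succ, ← hAB.law 0]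
      exact affineLaw_tail_le (hAB.measurable_A 0) (hAB.measurable_B 0) ha0 h ih t
  refine ⟨(P {ω | t₀ < A 0 ω})⁻¹, ENNReal.inv_ne_top.2 (hpos' _), fun t ht => ?_⟩
  have hopen : IsOpen {x : ℝ | t < |x|} := isOpen_lt continuous_const continuous_abs
  have hd := (tendstoInMeasure_of_tendsto_ae
    (fun n => (hAB.measurable_perpetuitySum n).aestronglyMeasurable)
    (tendsto_perpetuitySum hS)).tendstoInDistribution
    (fun n => (hAB.measurable_perpetuitySum n).aemeasurable)
  have hlim := ProbabilityMeasure.le_liminf_measure_open_of_tendsto hd.tendsto hopen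
  have e : P {ω | t < |perpetuity A B ω|} = P.map (perpetuity A B) {x | t < |x|} := by
    rw [Measure.map_apply_of_aemeasurable (hAB.aemeasurable_perpetuity hS) hopen.measurableSet]
    rfl
  rw [e]
  refine hlim.trans ?_
  refine (liminf_le_liminf (v := fun _ => (P {ω | t₀ < A 0 ω})⁻¹ * P {ω | t < A 0 ω})
    (Eventually.of_forall fun n => ?_)).trans (by simp)
  have := hn n t
  rw [max_eq_left ht] at this
  rw [mul_comm, ← div_eq_mul_inv, ENNReal.le_div_iff_mul_le (Or.inl (hpos' _))
    (Or.inl (measure_ne_top _ _))]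
  exact this

/-! ### The lower bound -/

/-- A random variable that is not almost surely constant takes values on both sides of an
interval with positive probability. -/
theorem exists_lt_measure_ne_zero {ν : Measure ℝ} [IsProbabilityMeasure ν]
    (h : ∀ c : ℝ, ¬ ∀ᵐ x ∂ν, x = c) :
    ∃ c₁ c₂ : ℝ, c₁ < c₂ ∧ ν (Set.Iio c₁) ≠ 0 ∧ ν (Set.Ioi c₂) ≠ 0 := by
  obtain ⟨x, hx⟩ := Measure.nonempty_support (NeZero.ne ν)
  obtain ⟨y, hy, hxy⟩ : ∃ y ∈ ν.support, y ≠ x := by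
    by_contra! hc
    exact h x (mem_of_superset (Measure.support_mem_ae (μ := ν)) hc)
  have key : ∀ {u v : ℝ}, u ∈ ν.support → v ∈ ν.support → u < v →
      ∃ c₁ c₂ : ℝ, c₁ < c₂ ∧ ν (Set.Iio c₁) ≠ 0 ∧ ν (Set.Ioi c₂) ≠ 0 := by
    intro u v hu hv huv
    obtain ⟨c₁, h1, h2⟩ := exists_between huv
    obtain ⟨c₂, h3, h4⟩ := exists_between h2
    exact ⟨c₁, c₂, h3, ((Measure.mem_support_iff_forall _).1 hu _ (Iio_mem_nhds h1)).ne',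
      ((Measure.mem_support_iff_forall _).1 hv _ (Ioi_mem_nhds h4)).ne'⟩
  rcases lt_or_gt_of_ne hxy with hl | hl
  · exact key hy hx hl
  · exact key hx hy hl

section LowerBound

variable {Ω : Type*} [MeasurableSpace Ω] {P : Measure Ω} [IsProbabilityMeasure P]
  {a b : Ω → ℝ} {α : ℝ} {ν : Measure ℝ} [IsProbabilityMeasure ν]

omit [IsProbabilityMeasure P] in
/-- Two independent events for `(a, b)` and `X` that force `|a X + b| > t`. -/
theorem measure_mul_le_of_isStationaryLaw [SFinite P] (ha : Measurable a) (hb : Measurable b)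
    (hν : IsStationaryLaw (P.map fun ω => (a ω, b ω)) ν) {U : Set Ω} {V : Set ℝ} {t : ℝ}
    (hUV : ∀ᵐ ω ∂P, ω ∈ U → ∀ x ∈ V, t < |a ω * x + b ω|) :
    P U * ν V ≤ ν {x | t < |x|} := by
  have hm : MeasurableSet {x : ℝ | t < |x|} := measurableSet_lt measurable_const (by fun_prop)
  have hab : Measurable (fun ω => (a ω, b ω)) := ha.prodMk hb
  have h1 : (P.map fun ω => (a ω, b ω)).prod ν = (P.prod ν).map
      (Prod.map (fun ω => (a ω, b ω)) id) := by
    rw [← Measure.map_prod_map _ _ hab measurable_id, Measure.map_id]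
  have h2 : ν {x | t < |x|} = (P.prod ν) {q : Ω × ℝ | t < |a q.1 * q.2 + b q.1|} := by
    conv_lhs => rw [← hν, h1]
    rw [Measure.map_map (by fun_prop) (hab.prodMap measurable_id),
      Measure.map_apply (Measurable.comp (by fun_prop) (hab.prodMap measurable_id)) hm]
    rfl
  rw [h2, ← Measure.prod_prod]
  refine measure_mono_ae ?_
  filter_upwards [Measure.quasiMeasurePreserving_fst.ae hUV] with q hq
  exact fun hq' => hq hq'.1 q.2 hq'.2

theorem RegularlyVaryingTail.exists_le_tail_of_isStationaryLaw (h : RegularlyVaryingTail P a α)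
    (ha : Measurable a) (hb : Measurable b) (ha0 : ∀ᵐ ω ∂P, 0 < a ω)
    (hν : IsStationaryLaw (P.map fun ω => (a ω, b ω)) ν)
    (hdeg : ∀ c : ℝ, ¬ ∀ᵐ x ∂ν, x = c)
    (hab : (fun t : ℝ => P.real {ω | t < a ω ∧ b ω < -t}) =o[atTop]
        (fun t : ℝ => P.real {ω | t < a ω})) :
    ∃ c : ℝ, 0 < c ∧ ∀ᶠ t in atTop, c * P.real {ω | t < a ω} ≤ ν.real {x | t < |x|} := by
  -- If `X ≤ 0` a.s., then `a c₂ + b ≤ 0` because `X > c₂` has positive probability. On `X < c₁`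
  -- this gives `a X + b ≤ -a (c₂ - c₁)`, so `a > t / (c₂ - c₁)` suffices, whatever `b` is.
  by_cases hpos : ν (Set.Ioi 0) = 0
  · obtain ⟨c₁, c₂, hc, h1, h2⟩ := exists_lt_measure_ne_zero hdeg
    have hneg : ∀ᵐ ω ∂P, a ω * c₂ + b ω ≤ 0 := by
      have hpr : (P.map fun ω => (a ω, b ω)).prod ν
          {p : (ℝ × ℝ) × ℝ | 0 < p.1.1 * p.2 + p.1.2} = 0 := by
        rw [← hν, Measure.map_apply (by fun_prop) measurableSet_Ioi] at hpos
        exact hpos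
      have hq := Measure.ae_ae_of_ae_prod (measure_eq_zero_iff_ae_notMem.1 hpr)
      have hq' := ae_of_ae_map (ha.prodMk hb).aemeasurable hq
      filter_upwards [ha0, hq'] with ω hω hx
      obtain ⟨x, hx2, hx⟩ := ((frequently_ae_mem_iff.2 h2).and_eventually hx).exists
      simp only [not_lt] at hx
      have := mul_le_mul_of_nonneg_left (le_of_lt (Set.mem_Ioi.1 hx2)) hω.le
      linarith
    have hδ : 0 < c₂ - c₁ := by linarith
    have hr := h.tendsto_ratio (inv_pos.2 hδ)
    have hp : 0 < (c₂ - c₁)⁻¹ ^ (-α) := Real.rpow_pos_of_pos (inv_pos.2 hδ) _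
    have hV : 0 < ν.real (Set.Iio c₁) :=
      ENNReal.toReal_pos h1 (measure_ne_top _ _)
    refine ⟨(c₂ - c₁)⁻¹ ^ (-α) / 2 * ν.real (Set.Iio c₁), by positivity, ?_⟩
    filter_upwards [hr.eventually (lt_mem_nhds (half_lt_self hp))] with t ht
    rw [lt_div_iff₀ (h.tail_pos t)] at ht
    have hk := measure_mul_le_of_isStationaryLaw (t := t) (U := {ω | t * (c₂ - c₁)⁻¹ < a ω})
      (V := Set.Iio c₁) ha hb hν (by
        filter_upwards [ha0, hneg] with ω hω hn hU x hx
        have hU : t * (c₂ - c₁)⁻¹ < a ω := hU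
        rw [← div_eq_mul_inv, div_lt_iff₀ hδ] at hU
        have := mul_le_mul_of_nonneg_left (le_of_lt (Set.mem_Iio.1 hx)) hω.le
        exact lt_of_lt_of_le (by linarith) (neg_le_abs _))
    have hk' := ENNReal.toReal_mono (measure_ne_top _ _) hk
    rw [ENNReal.toReal_mul] at hk'
    refine le_trans ?_ hk'
    rw [mul_right_comm]
    exact mul_le_mul_of_nonneg_right ht.le measureReal_nonneg
  · obtain ⟨δ, hδ, hV⟩ : ∃ δ : ℝ, 0 < δ ∧ ν (Set.Ioi δ) ≠ 0 := by
      by_contra! hc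
      refine hpos ?_
      have : Set.Ioi (0 : ℝ) = ⋃ n : ℕ, Set.Ioi (1 / ((n : ℝ) + 1)) := by
        ext x
        simp only [Set.mem_Ioi, Set.mem_iUnion]
        exact ⟨exists_nat_one_div_lt, fun ⟨n, hn⟩ => lt_trans Nat.one_div_pos_of_nat hn⟩
      rw [this, measure_iUnion_null_iff]
      exact fun n => hc _ Nat.one_div_pos_of_nat
    -- If `a > M t`, `b ≥ -t` and `X > δ`, then `a X + b > M δ t - t ≥ t`, since `M δ ≥ 2`. As `M ≥
    -- 1`, the excluded event `b < -t` lies within `{a > t, b < -t}`, which is negligible by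
    -- hypothesis.
    set M := max 1 (2 / δ) with hM
    have hM1 : 1 ≤ M := le_max_left _ _
    have hM0 : 0 < M := by linarith
    have hMδ : 2 ≤ M * δ := (div_le_iff₀ hδ).1 (le_max_right _ _)
    have hp : 0 < M ^ (-α) := Real.rpow_pos_of_pos hM0 _
    have hV' : 0 < ν.real (Set.Ioi δ) := ENNReal.toReal_pos hV (measure_ne_top _ _)
    refine ⟨M ^ (-α) / 4 * ν.real (Set.Ioi δ), by positivity, ?_⟩
    have hr := h.tendsto_ratio hM0
    have ho := hab.bound (show 0 < M ^ (-α) / 4 by positivity)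
    filter_upwards [hr.eventually (lt_mem_nhds (half_lt_self hp)), ho, eventually_gt_atTop 0]
      with t ht hto ht0
    rw [lt_div_iff₀ (h.tail_pos t)] at ht
    rw [Real.norm_of_nonneg measureReal_nonneg, Real.norm_of_nonneg measureReal_nonneg] at hto
    have hk := measure_mul_le_of_isStationaryLaw (t := t)
      (U := {ω | t * M < a ω} \ {ω | t < a ω ∧ b ω < -t}) (V := Set.Ioi δ) ha hb hν (by
        filter_upwards with ω hU x hx
        have hU1 : t * M < a ω := hU.1
        have hta : t < a ω := by nlinarith
        have hU2 : -t ≤ b ω := not_lt.1 fun hc => hU.2 ⟨hta, hc⟩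
        have hx : δ < x := hx
        have h3 : t * M * δ < a ω * x :=
          mul_lt_mul'' hU1 hx (by positivity) hδ.le
        refine lt_of_lt_of_le ?_ (le_abs_self _)
        nlinarith)
    have hk' := ENNReal.toReal_mono (measure_ne_top _ _) hk
    rw [ENNReal.toReal_mul] at hk'
    refine le_trans ?_ hk'
    rw [mul_right_comm]
    refine mul_le_mul_of_nonneg_right ?_ measureReal_nonneg
    have := le_measureReal_sdiff (μ := P) (s₁ := {ω | t * M < a ω})
      (s₂ := {ω | t < a ω ∧ b ω < -t})
    refine le_trans ?_ this
    linarith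

end LowerBound

/-! ### Assembly of the theorem -/

theorem mainTheorem3 {Ω : Type*} [MeasurableSpace Ω] (P : Measure Ω) [IsProbabilityMeasure P]
    -- the i.i.d. sequence of pairs `(A, B)`, with generic element `(A 0, B 0)`
    (A B : ℕ → Ω → ℝ) (hA : ∀ n, Measurable (A n)) (hB : ∀ n, Measurable (B n))
    (hindep : iIndepFun (fun n ω => (A n ω, B n ω)) P)
    (hident : ∀ n, IdentDistrib (fun ω => (A n ω, B n ω)) (fun ω => (A 0 ω, B 0 ω)) P P)
    -- the initial state, independent of the sequence
    (X₀ : Ω → ℝ) (hX₀ : Measurable X₀)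
    (hX₀_indep : IndepFun X₀ (fun ω n => (A n ω, B n ω)) P)
    (α : ℝ) (hα : 0 < α)
    (hA_pos : ∀ᵐ ω ∂P, 0 < A 0 ω)
    -- `A` has a regularly varying tail and a finite moment of order `α`
    (hA_tail : ∀ y : ℝ, 0 < y →
      AsympEq (fun t => P.real {ω | t * y < A 0 ω}) (fun t => y ^ (-α) * P.real {ω | t < A 0 ω}))
    (hA_int : Integrable (fun ω => A 0 ω ^ α) P)
    -- the tail of the product of `A` and an independent copy of `A`
    (hA_conv : AsympEq (fun t => (P.prod P).real {p : Ω × Ω | t < A 0 p.1 * A 0 p.2})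
      (fun t => 2 * (∫ ω, A 0 ω ^ α ∂P) * P.real {ω | t < A 0 ω}))
    (hA_moment : ∫ ω, A 0 ω ^ α ∂P < 1)
    (hB_tail : limsup (fun t : ℝ => P {ω | t < |B 0 ω|} / P {ω | t < A 0 ω}) atTop < ∞) :
    -- the series defining `X` converges absolutely, and the law of `X` is the unique stationary law
    (∀ᵐ ω ∂P, Summable (fun k => perpetuityTerm A B k ω)) ∧
    IsStationaryLaw (P.map (fun ω => (A 0 ω, B 0 ω))) (P.map (perpetuity A B)) ∧
    (∀ ν : Measure ℝ, IsProbabilityMeasure ν →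
      IsStationaryLaw (P.map (fun ω => (A 0 ω, B 0 ω))) ν → ν = P.map (perpetuity A B)) ∧
    -- weak convergence of the chain
    TendstoInDistribution (affineChain A B X₀) atTop (perpetuity A B) (fun _ => P) P ∧
    -- the upper bound
    ((fun t : ℝ => P.real {ω | t < |perpetuity A B ω|}) =O[atTop]
      (fun t : ℝ => P.real {ω | t < A 0 ω})) ∧
    -- the two-sided bound, for non-degenerate coefficients
    ((∀ c : ℝ, ¬ ∀ᵐ ω ∂P, A 0 ω * c + B 0 ω = c) →
      ((fun t : ℝ => P.real {ω | t < A 0 ω ∧ B 0 ω < -t}) =o[atTop]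
        (fun t : ℝ => P.real {ω | t < A 0 ω})) →
      WeaklyEquiv (fun t : ℝ => P {ω | t < |perpetuity A B ω|})
        (fun t : ℝ => P {ω | t < A 0 ω})) := by
  have hAB : IsIIDPairs P (P.map fun ω => (A 0 ω, B 0 ω)) A B :=
    ⟨hA, hB, hindep, fun n => (hident n).map_eq⟩
  have hRV : RegularlyVaryingTail P (A 0) α := hA_tail
  obtain ⟨C, hC, hBC⟩ := exists_tail_le_mul hRV.tail_pos hB_tail
  have hδ : 0 < min α 1 := lt_min hα one_pos
  have hAδ := lintegral_enorm_rpow_lt_one hA_pos hA_int hA_moment hδ (min_le_left _ _)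
  have hBδ := lintegral_enorm_rpow_le_of_tail_le (hA 0) (hB 0) hA_pos hBC hδ
  have hκA : ∫⁻ p, ‖p.1‖ₑ ^ min α 1 ∂(P.map fun ω => (A 0 ω, B 0 ω)) < 1 := by
    rwa [lintegral_map (by fun_prop) (hAB.measurable_pair 0)]
  have hκB : ∫⁻ p, ‖p.2‖ₑ ^ min α 1 ∂(P.map fun ω => (A 0 ω, B 0 ω)) ≠ ∞ := by
    rw [lintegral_map (by fun_prop) (hAB.measurable_pair 0)]
    exact (hBδ.trans_lt (ENNReal.mul_lt_top hC.lt_top (hAδ.trans ENNReal.one_lt_top))).ne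
  have hS := hAB.summable_perpetuityTerm hδ (min_le_right _ _) hκA hκB
  have hprod := hAB.tendsto_prod_range_zero hδ (min_le_right _ _) hκA
  have hX := hAB.aemeasurable_perpetuity hS
  have hstat := hAB.isStationaryLaw_perpetuity hS
  obtain ⟨d, t₀, -, -, ht₀, hthr⟩ :=
    hRV.exists_threshold (hA 0) hA_pos hA_int hA_moment hA_conv hB_tail
  obtain ⟨D, hD, hXD⟩ := hAB.exists_perpetuity_tail_le hA_pos hRV.tail_pos hS ht₀ hthr
  have hG : ∀ t, P {ω | t < A 0 ω} ≠ 0 := fun t ht => by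
    simpa [Measure.real, ht] using hRV.tail_pos t
  refine ⟨hS, hstat, fun ν hν hνs => hAB.eq_map_perpetuity_of_isStationaryLaw hS hprod hνs,
    hAB.tendstoInDistribution_affineChain hS hprod hX₀, ?_, fun hdeg hAB_tail => ⟨?_, ?_⟩⟩
  · refine IsBigO.of_bound D.toReal ?_
    filter_upwards [eventually_ge_atTop t₀] with t ht
    rw [Real.norm_of_nonneg measureReal_nonneg, Real.norm_of_nonneg measureReal_nonneg,
      Measure.real, Measure.real, ← ENNReal.toReal_mul]
    exact ENNReal.toReal_mono (ENNReal.mul_ne_top hD (measure_ne_top _ _)) (hXD t ht)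
  · have : IsProbabilityMeasure (P.map (perpetuity A B)) := Measure.isProbabilityMeasure_map hX
    -- If `X = c` a.s., then `a X + b = c` a.s. by stationarity, and substituting `X = c` makes `c`
    -- a fixed point of the coefficients.
    have hνdeg : ∀ c : ℝ, ¬ ∀ᵐ x ∂(P.map (perpetuity A B)), x = c := by
      intro c hc
      refine hdeg c ?_
      rw [← hstat] at hc
      have h1 := ae_of_ae_map (by fun_prop) hc
      have h2 := Measure.ae_ae_of_ae_prod h1
      have h3 := ae_of_ae_map (hAB.measurable_pair 0).aemeasurable h2
      rw [hstat] at hc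
      filter_upwards [h3] with ω hω
      obtain ⟨x, hx, hxc⟩ := (hω.and hc).exists
      rwa [hxc] at hx
    obtain ⟨c, hc, hcl⟩ := hRV.exists_le_tail_of_isStationaryLaw (hA 0) (hB 0) hA_pos hstat hνdeg
      hAB_tail
    refine lt_of_lt_of_le (ENNReal.ofReal_pos.2 hc)
      (le_liminf_of_le (by isBoundedDefault) ?_)
    filter_upwards [hcl] with t ht
    rw [ENNReal.le_div_iff_mul_le (Or.inl (hG t)) (Or.inl (measure_ne_top _ _)),
      ← ofReal_measureReal (measure_ne_top P _), ← ENNReal.ofReal_mul hc.le]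
    refine (ENNReal.ofReal_le_ofReal ht).trans (le_of_eq ?_)
    rw [ofReal_measureReal (measure_ne_top _ _), Measure.map_apply_of_aemeasurable hX
      (measurableSet_lt measurable_const (by fun_prop))]
    rfl
  · refine lt_of_le_of_lt (limsup_le_of_le (by isBoundedDefault) ?_) hD.lt_top
    filter_upwards [eventually_ge_atTop t₀] with t ht
    exact ENNReal.div_le_of_le_mul (hXD t ht)
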